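/- Let $X$ be a real normed space of dimension $2$ (automatically a Banach space). The norm of a real Banach space $Z$ is called \emph{octahedral} if for every finite-dimensional subspace $E\subseteq Z$ and every $\varepsilon>0$ there is $y\in Z$ with $\|y\|=1$ such that $\|x+\lambda y\|\ge(1-\varepsilon)(\|x\|+|\lambda|)$ for all $x\in E$ and all $\lambda\in\mathbb R$. For real Banach spaces $Y,X$ let $Y\widehat\otimes_\varepsilon X$ denote the injective tensor product, i.e. the completion of $Y\otimes X$ for the norm $\|u\|_\varepsilon=\sup\{|(f\otimes g)(u)| : f\in Y^*,\ g\in X^*,\ \|f\|\le 1,\ \|g\|\le 1\}$. Let $\ell_1$, $c_0$ and $L_1=L_1[0,1]$ be the usual real Banach spaces, and let $L(c_0,X)$ be the space of bounded linear operators from $c_0$ to $X$ with the operator norm. Then there is a surjective linear isometry $\Phi:\ell_1\widehat\otimes_\varepsilon X\to L(c_0,X)$ with $\Phi(a\otimes x)(z)=\sum_n a_n z_n\,x$ for all $a\in\ell_1$, $x\in X$, $z\in c_0$, and the norms of $\ell_1\widehat\otimes_\varepsilon X$, of $L(c_0,X)$ and of $L_1\widehat\otimes_\varepsilon X$ are all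 octahedral. -/

import Mathlib

open scoped TensorProduct ZeroAtInfty

noncomputable section

/-- The norm of a real normed space `Z` is octahedral: for every finite-dimensional subspace `E`
and every `ε > 0` there is a unit vector `y` with
`‖x + c • y‖ ≥ (1 - ε) (‖x‖ + |c|)` for all `x ∈ E` and all real `c`. -/
def HasOctahedralNorm (Z : Type*) [NormedAddCommGroup Z] [NormedSpace ℝ Z] : Prop :=
  ∀ E : Submodule ℝ Z, FiniteDimensional ℝ E → ∀ ε : ℝ, 0 < ε →
    ∃ y : Z, ‖y‖ = 1 ∧ ∀ x ∈ E, ∀ c : ℝ, (1 - ε) * (‖x‖ + |c|) ≤ ‖x + c • y‖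

/-- The algebraic tensor product `X ⊗ Y`, as a copy that carries the injective norm. -/
def AlgInjTensor (X Y : Type*) [NormedAddCommGroup X] [NormedSpace ℝ X]
    [NormedAddCommGroup Y] [NormedSpace ℝ Y] : Type _ := X ⊗[ℝ] Y

namespace AlgInjTensor

variable {X Y : Type*} [NormedAddCommGroup X] [NormedSpace ℝ X]
  [NormedAddCommGroup Y] [NormedSpace ℝ Y]

instance : AddCommGroup (AlgInjTensor X Y) := inferInstanceAs (AddCommGroup (X ⊗[ℝ] Y))

instance : Module ℝ (AlgInjTensor X Y) := inferInstanceAs (Module ℝ (X ⊗[ℝ] Y))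

/-- The identity map from `X ⊗ Y` to its normed copy. -/
def ofTensor : X ⊗[ℝ] Y ≃ₗ[ℝ] AlgInjTensor X Y := LinearEquiv.refl ℝ (X ⊗[ℝ] Y)

/-- The elementary tensor `x ⊗ y`. -/
def tmul (x : X) (y : Y) : AlgInjTensor X Y := ofTensor (x ⊗ₜ[ℝ] y)

/-- The linear functional `f ⊗ g` on `X ⊗ Y`, with `(f ⊗ g) (x ⊗ y) = f x * g y`. -/
def pairing (f : StrongDual ℝ X) (g : StrongDual ℝ Y) : AlgInjTensor X Y →ₗ[ℝ] ℝ :=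
  LinearMap.mul' ℝ ℝ ∘ₗ TensorProduct.map (f : X →ₗ[ℝ] ℝ) (g : Y →ₗ[ℝ] ℝ) ∘ₗ
    (ofTensor (X := X) (Y := Y)).symm.toLinearMap

theorem pairing_ofTensor (f : StrongDual ℝ X) (g : StrongDual ℝ Y) (t : X ⊗[ℝ] Y) :
    pairing f g (ofTensor t) =
      LinearMap.mul' ℝ ℝ (TensorProduct.map (f : X →ₗ[ℝ] ℝ) (g : Y →ₗ[ℝ] ℝ) t) := by
  simp [pairing]

theorem pairing_tmul (f : StrongDual ℝ X) (g : StrongDual ℝ Y) (x : X) (y : Y) :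
    pairing f g (tmul x y) = f x * g y := by
  simp [tmul, pairing_ofTensor]

theorem pairing_smul_smul (r s : ℝ) (f : StrongDual ℝ X) (g : StrongDual ℝ Y)
    (u : AlgInjTensor X Y) : pairing (r • f) (s • g) u = r * s * pairing f g u := by
  obtain ⟨t, rfl⟩ := ofTensor.surjective u
  induction t with
  | zero => simp
  | tmul x y =>
    simp only [pairing_ofTensor, TensorProduct.map_tmul, LinearMap.mul'_apply,
      ContinuousLinearMap.coe_coe, _root_.smul_apply, smul_eq_mul]
    ring
  | add a b ha hb => rw [map_add, map_add, map_add, ha, hb]; ring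

/-- Pairs of functionals in the closed unit balls of the two dual spaces. -/
abbrev DualBalls (X Y : Type*) [NormedAddCommGroup X] [NormedSpace ℝ X]
    [NormedAddCommGroup Y] [NormedSpace ℝ Y] : Type _ :=
  {p : StrongDual ℝ X × StrongDual ℝ Y // ‖p.1‖ ≤ 1 ∧ ‖p.2‖ ≤ 1}

instance : Nonempty (DualBalls X Y) := ⟨⟨(0, 0), by simp⟩⟩

/-- The injective norm `‖u‖ = sup {|(f ⊗ g) u| : ‖f‖ ≤ 1, ‖g‖ ≤ 1}`. -/
instance : Norm (AlgInjTensor X Y) :=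
  ⟨fun u => ⨆ p : DualBalls X Y, |pairing p.1.1 p.1.2 u|⟩

theorem norm_def (u : AlgInjTensor X Y) :
    ‖u‖ = ⨆ p : DualBalls X Y, |pairing p.1.1 p.1.2 u| := rfl

theorem bddAbove_pairing (u : AlgInjTensor X Y) :
    BddAbove (Set.range fun p : DualBalls X Y => |pairing p.1.1 p.1.2 u|) := by
  suffices h : ∃ C : ℝ, ∀ p : DualBalls X Y, |pairing p.1.1 p.1.2 u| ≤ C by
    obtain ⟨C, hC⟩ := h
    exact ⟨C, by rintro _ ⟨p, rfl⟩; exact hC p⟩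
  obtain ⟨t, rfl⟩ := ofTensor.surjective u
  induction t with
  | zero => exact ⟨0, fun p => by simp⟩
  | tmul x y =>
    refine ⟨‖x‖ * ‖y‖, fun p => ?_⟩
    have h1 : |p.1.1 x| ≤ ‖x‖ := (p.1.1.le_of_opNorm_le p.2.1 x).trans (by simp)
    have h2 : |p.1.2 y| ≤ ‖y‖ := (p.1.2.le_of_opNorm_le p.2.2 y).trans (by simp)
    have h3 : pairing p.1.1 p.1.2 (ofTensor (x ⊗ₜ[ℝ] y)) = p.1.1 x * p.1.2 y :=
      pairing_tmul _ _ _ _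
    rw [h3, abs_mul]
    gcongr
  | add a b ha hb =>
    obtain ⟨A, hA⟩ := ha
    obtain ⟨B, hB⟩ := hb
    refine ⟨A + B, fun p => ?_⟩
    rw [map_add, map_add]
    exact (abs_add_le _ _).trans (add_le_add (hA p) (hB p))

theorem abs_pairing_le (u : AlgInjTensor X Y) (p : DualBalls X Y) :
    |pairing p.1.1 p.1.2 u| ≤ ‖u‖ :=
  le_ciSup (bddAbove_pairing u) p

/-- The functionals `f ⊗ g` separate the points of `X ⊗ Y`. -/
theorem eq_zero_of_pairing (u : AlgInjTensor X Y)
    (h : ∀ (f : StrongDual ℝ X) (g : StrongDual ℝ Y), pairing f g u = 0) : u = 0 := by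
  obtain ⟨t, rfl⟩ := ofTensor.surjective u
  let b := Module.Free.chooseBasis ℝ Y
  let e := TensorProduct.equivFinsuppOfBasisRight (M := X) b
  let c := e t
  have ht : t = ∑ i ∈ c.support, c i ⊗ₜ[ℝ] b i := by
    have := TensorProduct.equivFinsuppOfBasisRight_symm_apply (M := X) b c
    rw [Finsupp.sum] at this
    rw [← this]
    exact (e.symm_apply_apply t).symm
  have hf : ∀ f : StrongDual ℝ X, ∑ i ∈ c.support, f (c i) • b i = 0 := by
    intro f
    refine SeparatingDual.eq_zero_of_forall_dual_eq_zero (R := ℝ) fun g => ?_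
    have h1 := h f g
    rw [ht, pairing_ofTensor] at h1
    simpa using h1
  have hc : c = 0 := by
    ext i
    by_contra hi
    refine hi (SeparatingDual.eq_zero_of_forall_dual_eq_zero (R := ℝ) fun f => ?_)
    exact linearIndependent_iff'.1 b.linearIndependent c.support (fun i => f (c i)) (hf f) i
      (Finsupp.mem_support_iff.2 hi)
  rw [(LinearEquiv.map_eq_zero_iff e).1 hc, map_zero]

theorem norm_inv_smul_le {V : Type*} [NormedAddCommGroup V] [NormedSpace ℝ V] (v : V) :
    ‖(‖v‖ + 1)⁻¹ • v‖ ≤ 1 := by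
  rw [norm_smul, norm_inv, Real.norm_of_nonneg (by positivity), inv_mul_le_one₀ (by positivity)]
  linarith

theorem normCore : NormedSpace.Core ℝ (AlgInjTensor X Y) where
  norm_nonneg u := Real.iSup_nonneg fun _ => abs_nonneg _
  norm_smul r u := by
    simp only [norm_def, map_smul, smul_eq_mul, abs_mul, Real.norm_eq_abs]
    exact (Real.mul_iSup_of_nonneg (abs_nonneg r) _).symm
  norm_triangle u v := by
    refine ciSup_le fun p => ?_
    rw [map_add]
    exact (abs_add_le _ _).trans (add_le_add (abs_pairing_le u p) (abs_pairing_le v p))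
  norm_eq_zero_iff u := by
    constructor
    · intro h
      refine eq_zero_of_pairing u fun f g => ?_
      have h1 := abs_pairing_le u ⟨((‖f‖ + 1)⁻¹ • f, (‖g‖ + 1)⁻¹ • g),
        norm_inv_smul_le f, norm_inv_smul_le g⟩
      rw [h] at h1
      have h2 := abs_nonpos_iff.1 h1
      rw [pairing_smul_smul] at h2
      have h4 : (‖f‖ + 1)⁻¹ * (‖g‖ + 1)⁻¹ ≠ 0 := by positivity
      exact (mul_eq_zero.1 h2).resolve_left h4
    · rintro rfl
      simp [norm_def]

instance : NormedAddCommGroup (AlgInjTensor X Y) := NormedAddCommGroup.ofCore normCore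

instance : NormedSpace ℝ (AlgInjTensor X Y) := NormedSpace.ofCore normCore

end AlgInjTensor

/-- The (completed) injective tensor product of `X` and `Y`: the completion of the algebraic
tensor product for the injective norm. -/
abbrev InjTensor (X Y : Type*) [NormedAddCommGroup X] [NormedSpace ℝ X]
    [NormedAddCommGroup Y] [NormedSpace ℝ Y] : Type _ :=
  UniformSpace.Completion (AlgInjTensor X Y)

/-- The elementary tensor `x ⊗ y` in the completed injective tensor product. -/
def InjTensor.tmul {X Y : Type*} [NormedAddCommGroup X] [NormedSpace ℝ X]
    [NormedAddCommGroup Y] [NormedSpace ℝ Y] (x : X) (y : Y) : InjTensor X Y :=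
  ((AlgInjTensor.tmul x y : AlgInjTensor X Y) : UniformSpace.Completion (AlgInjTensor X Y))

/-- The real Banach space `ℓ₁` of absolutely summable sequences. -/
abbrev EllOne : Type := lp (fun _ : ℕ => ℝ) 1

/-- The real Banach space `c₀` of null sequences with the supremum norm (`ℕ` is discrete, so
vanishing at infinity means tending to zero). -/
abbrev CZero : Type := C₀(ℕ, ℝ)

/-- The real Banach space `L₁[0,1]` for Lebesgue measure. -/
abbrev LOne : Type := MeasureTheory.Lp ℝ 1 (MeasureTheory.volume.restrict (Set.Icc (0 : ℝ) 1))

end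

/-!
The theorem rests on two facts about octahedral norms.

The norms of `ℓ₁` and `L₁` are octahedral, because a normalised function supported on a small set is
almost `ℓ₁`-orthogonal to finitely many given functions (`hasOctahedralNorm_ellOne`,
`hasOctahedralNorm_lOne`).

The dual of a two-dimensional space `X` is almost isometric to a subspace of `ℓ₁ᵐ`: there are
`y k ∈ X` with `(1 - ε) ‖g‖ ≤ ∑ k, |g (y k)| ≤ ‖g‖` for every functional `g`
(`exists_sum_abs_dual_near`). This is the two-dimensional phenomenon that every centrally symmetric
polygon is a zonotope. Explicitly, let `n (θ)` be the value of a norm of the plane in the direction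
`θ`. Convexity says that `n'' + n ≥ 0`, and `|sin|` is, up to a factor, the Green function of
`n ↦ n'' + n` for the period `π`; hence `n` is a positive combination of translates of `|sin|`,
which are absolute values of linear functionals. The discrete version
`sum_second_difference_mul_abs_sin` yields a finite sum that agrees with the norm on a grid of
directions, and Lipschitz bounds do the rest.

These facts combine in `HasOctahedralNorm.injTensor`. The injective norm of `u ∈ Y ⊗ X` is the
supremum of `‖(id ⊗ g) u‖` over functionals `g` of norm one. If the norm of `Y` is octahedral, there
are unit vectors `h k ∈ Y` such that `‖f + ∑ k, a k • h k‖` is almost `‖f‖ + ∑ k, |a k|` for `f` in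
a given finite-dimensional subspace. For `v = ∑ k, h k ⊗ y k` the slice of `u + c v` along `g` has
norm almost `‖(id ⊗ g) u‖ + |c| ∑ k, |g (y k)|`, so `‖u + c v‖` is almost `‖u‖ + |c|`.

Finally the duality `c₀* = ℓ₁` maps `ℓ₁ ⊗ X` isometrically into the operators from `c₀` to `X`, and
onto since `X` has a finite basis (`InjTensor.exists_operatorEquiv`).
-/

noncomputable section

/-! ### Octahedral norms -/

/-- Octahedrality may be tested on finite subsets of a dense set, with `y` merely in the unit ball:
compactness of the unit sphere of a finite-dimensional subspace and homogeneity give the rest. -/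
theorem HasOctahedralNorm.of_dense {Z : Type*} [NormedAddCommGroup Z] [NormedSpace ℝ Z]
    {D : Set Z} (hD : Dense D) (h0 : (0 : Z) ∈ D)
    (h : ∀ F : Finset Z, (F : Set Z) ⊆ D → ∀ ε : ℝ, 0 < ε → ε < 1 →
      ∃ y : Z, ‖y‖ ≤ 1 ∧ ∀ x ∈ F, ∀ c : ℝ, (1 - ε) * (‖x‖ + |c|) ≤ ‖x + c • y‖) :
    HasOctahedralNorm Z := by
  classical
  intro E hE ε hε
  obtain ⟨η, hη, hη1, hηε⟩ : ∃ η : ℝ, 0 < η ∧ η < 1 ∧ 3 * η ≤ ε :=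
    ⟨min (ε / 3) (1 / 2), by positivity, by linarith [min_le_right (ε / 3) (1 / 2 : ℝ)],
      by linarith [min_le_left (ε / 3) (1 / 2 : ℝ)]⟩
  have hK : IsCompact ((Subtype.val : E → Z) '' Metric.sphere 0 1) :=
    (isCompact_sphere (0 : E) 1).image continuous_subtype_val
  obtain ⟨b, hbD, hb, hcov⟩ := hK.elim_finite_subcover_image (b := D)
    (c := fun d => Metric.ball d η) (fun _ _ => Metric.isOpen_ball) (by
      intro x _
      obtain ⟨d, hd, hxd⟩ := hD.exists_dist_lt x hη
      exact Set.mem_iUnion₂.2 ⟨d, hd, hxd⟩)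
  obtain ⟨y, hy, hyF⟩ := h (insert 0 hb.toFinset) (by
    intro x hx
    simp only [Finset.coe_insert, Set.Finite.coe_toFinset, Set.mem_insert_iff] at hx
    rcases hx with rfl | hx
    exacts [h0, hbD hx]) η hη hη1
  have hpos : 0 < ‖y‖ := by
    have := hyF 0 (Finset.mem_insert_self _ _) 1
    simp only [norm_zero, abs_one, zero_add, one_smul] at this
    linarith
  -- the estimate on the unit sphere of `E`
  have hsph : ∀ x ∈ E, ‖x‖ = 1 → ∀ c : ℝ, (1 - ε) * (1 + |c|) ≤ ‖x + c • y‖ := by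
    intro x hx hx1 c
    obtain ⟨d, hd, hxd⟩ := Set.mem_iUnion₂.1 (hcov ⟨⟨x, hx⟩, by simpa using hx1, rfl⟩)
    have hxd' : ‖x - d‖ < η := by simpa [dist_eq_norm] using hxd
    have h1 := hyF d (Finset.mem_insert_of_mem (hb.mem_toFinset.2 hd)) c
    have h2 : ‖x‖ - ‖x - d‖ ≤ ‖d‖ := by simpa using norm_sub_norm_le x (x - d)
    have h3 : ‖d + c • y‖ ≤ ‖x + c • y‖ + ‖x - d‖ := by
      have := norm_sub_le (x + c • y) (x - d)
      rwa [show x + c • y - (x - d) = d + c • y by abel] at this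
    have h4 : (1 - η) * (1 - η + |c|) ≤ (1 - η) * (‖d‖ + |c|) := by gcongr; linarith
    nlinarith [abs_nonneg c, mul_nonneg (sub_nonneg.2 hηε) (abs_nonneg c)]
  refine ⟨‖y‖⁻¹ • y, by rw [norm_smul, norm_inv, norm_norm, inv_mul_cancel₀ hpos.ne'], ?_⟩
  intro x hx c
  rcases le_or_gt 1 ε with h1 | h1
  · exact (mul_nonpos_of_nonpos_of_nonneg (by linarith) (by positivity)).trans (norm_nonneg _)
  have hc : |c| ≤ |c * ‖y‖⁻¹| := by
    rw [abs_mul, abs_of_pos (inv_pos.2 hpos)]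
    exact le_mul_of_one_le_right (abs_nonneg c) ((one_le_inv₀ hpos).2 hy)
  rw [smul_smul]
  refine (mul_le_mul_of_nonneg_left (add_le_add le_rfl hc) (by linarith)).trans ?_
  generalize c * ‖y‖⁻¹ = c
  rcases eq_or_ne x 0 with rfl | hx0
  · have := hyF 0 (Finset.mem_insert_self _ _) c
    refine le_trans ?_ this
    gcongr
    linarith
  · have hx' : 0 < ‖x‖ := norm_pos_iff.2 hx0
    have := hsph (‖x‖⁻¹ • x) (E.smul_mem _ hx)
      (by rw [norm_smul, norm_inv, norm_norm, inv_mul_cancel₀ hx'.ne']) (‖x‖⁻¹ * c)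
    rw [mul_smul, ← smul_add, norm_smul, norm_inv, norm_norm, abs_mul, abs_inv, abs_norm] at this
    rw [le_inv_mul_iff₀ hx'] at this
    refine le_of_eq_of_le ?_ this
    field_simp

/-- Iterating octahedrality yields vectors that span an almost isometric copy of `ℓ₁ᵐ`
which is almost `ℓ₁`-orthogonal to a given finite-dimensional subspace. -/
theorem HasOctahedralNorm.exists_fin {Y : Type*} [NormedAddCommGroup Y] [NormedSpace ℝ Y]
    (hY : HasOctahedralNorm Y) (m : ℕ) : ∀ (E : Submodule ℝ Y), FiniteDimensional ℝ E →
      ∀ ε : ℝ, 0 < ε → ε < 1 → ∃ h : Fin m → Y, (∀ k, ‖h k‖ = 1) ∧ ∀ x ∈ E, ∀ a : Fin m → ℝ,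
        (1 - ε) * (‖x‖ + ∑ k, |a k|) ≤ ‖x + ∑ k, a k • h k‖ := by
  induction m with
  | zero =>
    intro E _ ε hε _
    refine ⟨Fin.elim0, fun k => k.elim0, fun x _ a => ?_⟩
    simp only [Finset.univ_eq_empty, Finset.sum_empty, add_zero]
    nlinarith [norm_nonneg x]
  | succ m ih =>
    intro E _ ε hε hε1
    obtain ⟨y, hy, hyE⟩ := hY E inferInstance (ε / 2) (by positivity)
    obtain ⟨h, hh, hhE⟩ := ih (E ⊔ Submodule.span ℝ {y}) inferInstance (ε / 2) (by positivity)
      (by linarith)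
    refine ⟨Fin.cons y h, Fin.cases hy hh, fun x hx a => ?_⟩
    have h1 := hyE x hx (a 0)
    have h2 := hhE (x + a 0 • y) (Submodule.add_mem_sup hx
      (Submodule.smul_mem _ _ (Submodule.mem_span_singleton_self y))) (fun k => a k.succ)
    simp only [Fin.sum_univ_succ, Fin.cons_zero, Fin.cons_succ, ← add_assoc]
    refine le_trans ?_ h2
    have hs : 0 ≤ ∑ k : Fin m, |a k.succ| := Finset.sum_nonneg fun _ _ => abs_nonneg _
    have h3 : (1 - ε / 2) * ((1 - ε / 2) * (‖x‖ + |a 0|) + ∑ k : Fin m, |a k.succ|) ≤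
        (1 - ε / 2) * (‖x + a 0 • y‖ + ∑ k : Fin m, |a k.succ|) := by
      gcongr
      linarith
    refine le_trans ?_ h3
    nlinarith [norm_nonneg x, abs_nonneg (a 0), mul_nonneg hε.le hs,
      mul_nonneg (sq_nonneg ε) (add_nonneg (norm_nonneg x) (abs_nonneg (a 0)))]

theorem HasOctahedralNorm.of_linearIsometryEquiv {Y Z : Type*} [NormedAddCommGroup Y]
    [NormedSpace ℝ Y] [NormedAddCommGroup Z] [NormedSpace ℝ Z] (e : Y ≃ₗᵢ[ℝ] Z)
    (hY : HasOctahedralNorm Y) : HasOctahedralNorm Z := by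
  intro E _ ε hε
  obtain ⟨y, hy, hyE⟩ := hY (E.map (e.symm.toLinearEquiv : Z →ₗ[ℝ] Y)) inferInstance ε hε
  refine ⟨e y, by simpa using hy, fun x hx c => ?_⟩
  have := hyE (e.symm x) (Submodule.mem_map_of_mem hx) c
  rw [← e.norm_map (e.symm x + c • y), map_add, map_smul] at this
  simpa using this

/-! ### Slices of tensors -/

namespace AlgInjTensor

variable {X Y : Type*} [NormedAddCommGroup X] [NormedSpace ℝ X]
  [NormedAddCommGroup Y] [NormedSpace ℝ Y]

/-- The map `id ⊗ g : Y ⊗ X → Y` for a functional `g` on `X`. -/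
def slice (g : StrongDual ℝ X) : AlgInjTensor Y X →ₗ[ℝ] Y :=
  (TensorProduct.rid ℝ Y).toLinearMap ∘ₗ LinearMap.lTensor Y (g : X →ₗ[ℝ] ℝ) ∘ₗ
    (ofTensor (X := Y) (Y := X)).symm.toLinearMap

@[simp]
theorem slice_tmul (g : StrongDual ℝ X) (y : Y) (x : X) : slice g (tmul y x) = g x • y := by
  simp [slice, tmul]

theorem induction_tmul {p : AlgInjTensor Y X → Prop} (zero : p 0) (tmul : ∀ y x, p (tmul y x))
    (add : ∀ u v, p u → p v → p (u + v)) (u : AlgInjTensor Y X) : p u := by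
  obtain ⟨t, rfl⟩ := ofTensor.surjective u
  induction t with
  | zero => simpa using zero
  | tmul y x => exact tmul y x
  | add a b ha hb => rw [map_add]; exact add _ _ ha hb

theorem slice_smul (r : ℝ) (g : StrongDual ℝ X) (u : AlgInjTensor Y X) :
    slice (r • g) u = r • slice g u := by
  induction u using induction_tmul with
  | zero => simp
  | tmul y x => simp [mul_smul]
  | add u v hu hv => simp [hu, hv]

theorem pairing_eq_slice (f : StrongDual ℝ Y) (g : StrongDual ℝ X) (u : AlgInjTensor Y X) :
    pairing f g u = f (slice g u) := by
  induction u using induction_tmul with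
  | zero => simp
  | tmul y x => simp [pairing_tmul, mul_comm]
  | add u v hu hv => simp [hu, hv]

theorem norm_slice_le {g : StrongDual ℝ X} (hg : ‖g‖ ≤ 1) (u : AlgInjTensor Y X) :
    ‖slice g u‖ ≤ ‖u‖ := by
  obtain ⟨f, hf, hfu⟩ := exists_dual_vector'' ℝ (slice g u)
  have := abs_pairing_le u ⟨(f, g), hf, hg⟩
  simpa [pairing_eq_slice, hfu] using this

theorem norm_le_of_slice {u : AlgInjTensor Y X} {C : ℝ}
    (h : ∀ g : StrongDual ℝ X, ‖g‖ ≤ 1 → ‖slice g u‖ ≤ C) : ‖u‖ ≤ C := by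
  rw [norm_def]
  refine ciSup_le fun p => ?_
  rw [pairing_eq_slice]
  refine le_trans ?_ (h p.1.2 p.2.2)
  simpa using p.1.1.le_of_opNorm_le p.2.1 (slice p.1.2 u)

/-- The injective norm is approximated by slices along functionals of norm exactly one. -/
theorem exists_slice_ge [Nontrivial X] (u : AlgInjTensor Y X) {ε : ℝ} (hε : 0 < ε) :
    ∃ g : StrongDual ℝ X, ‖g‖ = 1 ∧ (1 - ε) * ‖u‖ ≤ ‖slice g u‖ := by
  rcases (norm_nonneg u).eq_or_lt with hu | hu
  · obtain ⟨x, hx⟩ := exists_ne (0 : X)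
    obtain ⟨g, hg, -⟩ := exists_dual_vector ℝ x (norm_ne_zero_iff.2 hx)
    exact ⟨g, hg, by simp [← hu]⟩
  · by_contra! hcon
    refine absurd (norm_le_of_slice (u := u) (C := max ((1 - ε) * ‖u‖) 0) fun g hg => ?_)
      (not_le.2 (max_lt (by nlinarith) hu))
    rcases eq_or_ne g 0 with rfl | hg0
    · have : slice (0 : StrongDual ℝ X) u = 0 := by simp [slice]
      simp [this]
    · have hg' : 0 < ‖g‖ := norm_pos_iff.2 hg0
      have h1 := hcon (‖g‖⁻¹ • g) (by rw [norm_smul, norm_inv, norm_norm, inv_mul_cancel₀ hg'.ne'])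
      rw [slice_smul, norm_smul, norm_inv, norm_norm] at h1
      refine le_max_of_le_left (le_trans ?_ h1.le)
      exact le_mul_of_one_le_left (norm_nonneg _) ((one_le_inv₀ hg').2 hg)

/-- All slices of a tensor lie in one finite-dimensional subspace. -/
theorem exists_slice_mem (u : AlgInjTensor Y X) : ∃ E : Submodule ℝ Y, FiniteDimensional ℝ E ∧
    ∀ g : StrongDual ℝ X, slice g u ∈ E := by
  induction u using induction_tmul with
  | zero => exact ⟨⊥, inferInstance, by simp⟩
  | tmul y x =>
    exact ⟨Submodule.span ℝ {y}, inferInstance, fun g => by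
      rw [slice_tmul]; exact Submodule.smul_mem _ _ (Submodule.mem_span_singleton_self y)⟩
  | add u v hu hv =>
    obtain ⟨E, _, hE⟩ := hu
    obtain ⟨E', _, hE'⟩ := hv
    exact ⟨E ⊔ E', inferInstance, fun g => by
      rw [map_add]; exact Submodule.add_mem_sup (hE g) (hE' g)⟩

end AlgInjTensor

/-! ### Octahedrality of injective tensor products -/

/-- If the norm of `Y` is octahedral and `X*` is almost isometric to subspaces of the spaces
`ℓ₁ᵐ`, then the norm of the injective tensor product of `Y` and `X` is octahedral. Given vectors
`y k` that realise the embedding of `X*` and `h k` from `HasOctahedralNorm.exists_fin`,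
the tensor `∑ k, h k ⊗ y k` is the required direction: in every slice along a norm-one functional
it acts as an almost unit vector that is almost `ℓ₁`-orthogonal to the given slices. -/
theorem HasOctahedralNorm.injTensor {X Y : Type*} [NormedAddCommGroup X] [NormedSpace ℝ X]
    [NormedAddCommGroup Y] [NormedSpace ℝ Y] [Nontrivial X] (hY : HasOctahedralNorm Y)
    (hX : ∀ ε : ℝ, 0 < ε → ∃ (m : ℕ) (y : Fin m → X), ∀ g : StrongDual ℝ X,
      (1 - ε) * ‖g‖ ≤ ∑ k, |g (y k)| ∧ ∑ k, |g (y k)| ≤ ‖g‖) :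
    HasOctahedralNorm (InjTensor Y X) := by
  classical
  refine .of_dense (D := Set.range ((↑) : AlgInjTensor Y X → InjTensor Y X))
    UniformSpace.Completion.denseRange_coe ⟨0, UniformSpace.Completion.coe_zero⟩ ?_
  intro F hF ε hε hε1
  obtain ⟨G, -, rfl⟩ := Finset.subset_set_image_iff.1 (Set.image_univ ▸ hF)
  choose E hE hmem using AlgInjTensor.exists_slice_mem (X := X) (Y := Y)
  have hfin : FiniteDimensional ℝ (G.sup E : Submodule ℝ Y) :=
    Submodule.finiteDimensional_finset_sup G E
  obtain ⟨m, y, hy⟩ := hX (ε / 2) (by positivity)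
  obtain ⟨h, hh, hhE⟩ := hY.exists_fin m (G.sup E) hfin (ε / 2) (by positivity) (by linarith)
  have hslice : ∀ g : StrongDual ℝ X, AlgInjTensor.slice g
      (∑ k, AlgInjTensor.tmul (h k) (y k)) = ∑ k, g (y k) • h k := by simp
  refine ⟨((∑ k, AlgInjTensor.tmul (h k) (y k) : AlgInjTensor Y X) : InjTensor Y X), ?_, ?_⟩
  · rw [UniformSpace.Completion.norm_coe]
    refine AlgInjTensor.norm_le_of_slice fun g hg => ?_
    rw [hslice]
    calc ‖∑ k, g (y k) • h k‖ ≤ ∑ k, ‖g (y k) • h k‖ := norm_sum_le _ _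
      _ = ∑ k, |g (y k)| := by simp [norm_smul, hh]
      _ ≤ 1 := (hy g).2.trans hg
  · intro x hx c
    obtain ⟨u, hu, rfl⟩ := Finset.mem_image.1 hx
    rw [← UniformSpace.Completion.coe_smul, ← UniformSpace.Completion.coe_add,
      UniformSpace.Completion.norm_coe, UniformSpace.Completion.norm_coe]
    obtain ⟨g, hg, hgu⟩ := AlgInjTensor.exists_slice_ge (X := X) u (half_pos hε)
    refine le_trans ?_ (AlgInjTensor.norm_slice_le hg.le _)
    rw [map_add, map_smul, hslice, Finset.smul_sum]
    simp only [smul_smul]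
    refine le_trans ?_ (hhE _ (Finset.le_sup (f := E) hu (hmem u g)) fun k => c * g (y k))
    simp only [abs_mul, ← Finset.mul_sum]
    have h1 := (hy g).1
    rw [hg, mul_one] at h1
    have h2 : (1 - ε / 2) * ((1 - ε / 2) * ‖u‖ + |c| * (1 - ε / 2)) ≤
        (1 - ε / 2) * (‖AlgInjTensor.slice g u‖ + |c| * ∑ k, |g (y k)|) := by
      gcongr
      linarith
    refine le_trans ?_ h2
    nlinarith [norm_nonneg u, abs_nonneg c,
      mul_nonneg (sq_nonneg ε) (add_nonneg (norm_nonneg u) (abs_nonneg c))]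

/-! ### Norms on the plane -/

/-- A discrete version of `∫ |sin (φ - θ)| (n'' + n) dφ = 2 n (θ)`, the integral being over one
period: `n` is a function of the angle with period `π = m δ`, and
`n (θ + δ) + n (θ - δ) - 2 cos δ n θ` plays the role of `n'' + n`. The proof is Green's identity
on the two arcs on which the sine has constant sign: the summands are increments of a discrete
Wronskian of `n` and the sine. -/
theorem sum_second_difference_mul_abs_sin (n : ℝ → ℝ) (hn : ∀ t, n (t + Real.pi) = n t) (m : ℕ)
    (hm : 0 < m) (j : ℕ) (hj : j < m) :
    ∑ k ∈ Finset.range m,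
      (n ((k + 1) * (Real.pi / m)) + n ((k - 1) * (Real.pi / m))
        - 2 * Real.cos (Real.pi / m) * n (k * (Real.pi / m))) *
        |Real.sin ((k - j) * (Real.pi / m))| =
      2 * Real.sin (Real.pi / m) * n (j * (Real.pi / m)) := by
  have hm0 : (0 : ℝ) < m := by exact_mod_cast hm
  set δ := Real.pi / m with hδ
  have hδm : m * δ = Real.pi := by rw [hδ]; field_simp
  have hδ0 : 0 < δ := by positivity
  set s : ℝ → ℝ := fun k => Real.sin ((k - j) * δ) with hs
  set q : ℝ → ℝ := fun k => n ((k + 1) * δ) + n ((k - 1) * δ) - 2 * Real.cos δ * n (k * δ) with hq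
  set W : ℕ → ℝ := fun k => n (k * δ) * s (k - 1) - n ((k - 1) * δ) * s k with hW
  have hstep : ∀ k : ℕ, q k * s k = W (k + 1) - W k := by
    intro k
    have h1 : s (k + 1) + s (k - 1) = 2 * Real.cos δ * s k := by
      simp only [hs]
      rw [show ((k : ℝ) + 1 - j) * δ = (k - j) * δ + δ by ring,
        show ((k : ℝ) - 1 - j) * δ = (k - j) * δ - δ by ring, Real.sin_add, Real.sin_sub]
      ring
    simp only [hW, hq, Nat.cast_add, Nat.cast_one, add_sub_cancel_right]
    linear_combination (n (k * δ)) * h1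
  have hsum : ∀ J : ℕ, ∑ k ∈ Finset.range J, q k * s k = W J - W 0 := by
    intro J
    rw [Finset.sum_congr rfl fun k _ => hstep k, Finset.sum_range_sub]
  -- on one period the sine changes its sign only at `k = j`
  have habs : ∀ k ∈ Finset.range m,
      q k * |s k| = q k * s k - 2 * (if k < j then q k * s k else 0) := by
    intro k hk
    have hkm : (k : ℝ) ≤ m := by exact_mod_cast (Finset.mem_range.1 hk).le
    have hjm : (j : ℝ) ≤ m := by exact_mod_cast hj.le
    split_ifs with hkj
    · have hkj' : (k : ℝ) ≤ j := by exact_mod_cast hkj.le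
      have : s k ≤ 0 := Real.sin_nonpos_of_nonpos_of_neg_pi_le
        (mul_nonpos_of_nonpos_of_nonneg (by linarith) hδ0.le)
        (by nlinarith [Nat.cast_nonneg (α := ℝ) k])
      rw [abs_of_nonpos this]
      ring
    · have hkj' : (j : ℝ) ≤ k := by exact_mod_cast not_lt.1 hkj
      have : 0 ≤ s k := Real.sin_nonneg_of_nonneg_of_le_pi
        (mul_nonneg (by linarith) hδ0.le)
        (by nlinarith [Nat.cast_nonneg (α := ℝ) j])
      rw [abs_of_nonneg this]
      ring
  have hfil : (Finset.range m).filter (· < j) = Finset.range j := by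
    ext k
    simp only [Finset.mem_filter, Finset.mem_range]
    omega
  have hmain : ∑ k ∈ Finset.range m, q k * |s k| = (W m - W 0) - 2 * (W j - W 0) := by
    rw [Finset.sum_congr rfl habs, Finset.sum_sub_distrib, ← Finset.mul_sum, ← Finset.sum_filter,
      hfil, hsum, hsum]
  have hWm : W m = - W 0 := by
    have e1 : s m = - s 0 := by
      simp only [hs]
      rw [show ((m : ℝ) - j) * δ = (0 - j) * δ + Real.pi by rw [← hδm]; ring, Real.sin_add_pi]
    have e2 : s (m - 1) = - s (0 - 1) := by
      simp only [hs]
      rw [show ((m : ℝ) - 1 - j) * δ = (0 - 1 - j) * δ + Real.pi by rw [← hδm]; ring,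
        Real.sin_add_pi]
    have e3 : n (m * δ) = n (0 * δ) := by
      rw [hδm, ← hn (0 * δ)]
      simp
    have e4 : n ((m - 1) * δ) = n ((0 - 1) * δ) := by
      rw [← hn ((0 - 1) * δ), ← hδm]
      congr 1
      ring
    simp only [hW, e1, e2, e3, e4, Nat.cast_zero]
    ring
  have hWj : W j = - (Real.sin δ * n (j * δ)) := by
    have e1 : s j = 0 := by simp [hs]
    have e2 : s (j - 1) = - Real.sin δ := by
      simp only [hs]
      rw [← Real.sin_neg]
      congr 1
      ring
    simp only [hW, e1, e2]
    ring
  change ∑ k ∈ Finset.range m, q k * |s k| = _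
  rw [hmain, hWm, hWj]
  ring

theorem Seminorm.abs_sub_le_of_plane (N : Seminorm ℝ ℂ) (z w : ℂ) :
    |N z - N w| ≤ (N 1 + N Complex.I) * ‖z - w‖ := by
  have h : ∀ z : ℂ, N z ≤ (N 1 + N Complex.I) * ‖z‖ := by
    intro z
    have h1 : N z ≤ |z.re| * N 1 + |z.im| * N Complex.I := by
      have h2 : z = z.re • (1 : ℂ) + z.im • Complex.I := by
        simp [Complex.re_add_im]
      conv_lhs => rw [h2]
      refine (map_add_le_add N _ _).trans ?_
      rw [map_smul_eq_mul, map_smul_eq_mul, Real.norm_eq_abs, Real.norm_eq_abs]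
    nlinarith [Complex.abs_re_le_norm z, Complex.abs_im_le_norm z, apply_nonneg N (1 : ℂ),
      apply_nonneg N Complex.I]
  exact (abs_sub_map_le_sub N z w).trans (h _)

/-- Seminorms that agree on the directions `exp (i j π / m)`, `j < m`, are uniformly close. Since
`m = 2 r` is even, the directions `1` and `i`, which determine the Lipschitz constants, are among
them. -/
theorem Seminorm.abs_sub_le_of_eq_grid (N S : Seminorm ℝ ℂ) (r : ℕ) (hr : 0 < r)
    (h : ∀ j < 2 * r, S (Complex.exp ((j * (Real.pi / (2 * r : ℕ)) : ℝ) * Complex.I)) =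
      N (Complex.exp ((j * (Real.pi / (2 * r : ℕ)) : ℝ) * Complex.I))) (z : ℂ) :
    |S z - N z| ≤ 2 * (N 1 + N Complex.I) * (Real.pi / (2 * r : ℕ)) * ‖z‖ := by
  have hr0 : (0 : ℝ) < r := by exact_mod_cast hr
  set δ := Real.pi / (2 * r : ℕ) with hδ
  have hδ0 : 0 < δ := by positivity
  have hδr : (2 * r) * δ = Real.pi := by rw [hδ]; push_cast; field_simp
  have h1 : S 1 = N 1 := by simpa using h 0 (by omega)
  have hI : S Complex.I = N Complex.I := by
    have := h r (by omega)
    rwa [show (r : ℝ) * δ = Real.pi / 2 by linarith, Complex.ofReal_div, Complex.ofReal_ofNat,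
      Complex.exp_pi_div_two_mul_I] at this
  -- for directions in the upper half plane, compare with the preceding grid point
  have hang : ∀ t : ℝ, 0 ≤ t → t < Real.pi → |S (Complex.exp (t * Complex.I)) -
      N (Complex.exp (t * Complex.I))| ≤ 2 * (N 1 + N Complex.I) * δ := by
    intro t ht0 htpi
    obtain ⟨j, hj, hj1, hj2⟩ : ∃ j : ℕ, j < 2 * r ∧ j * δ ≤ t ∧ t - j * δ ≤ δ := by
      refine ⟨⌊t / δ⌋₊, ?_, ?_, ?_⟩
      · rw [Nat.floor_lt (by positivity), div_lt_iff₀ hδ0]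
        push_cast
        linarith
      · rw [← le_div_iff₀ hδ0]
        exact Nat.floor_le (by positivity)
      · have := (Nat.lt_floor_add_one (t / δ)).le
        rw [div_le_iff₀ hδ0] at this
        linarith
    have hd : ‖Complex.exp (t * Complex.I) - Complex.exp ((j * δ : ℝ) * Complex.I)‖ ≤ δ := by
      have e : Complex.exp (t * Complex.I) - Complex.exp ((j * δ : ℝ) * Complex.I) =
          Complex.exp ((j * δ : ℝ) * Complex.I) *
            (Complex.exp (Complex.I * (t - j * δ : ℝ)) - 1) := by
        rw [mul_sub, ← Complex.exp_add]
        push_cast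
        ring_nf
      rw [e, norm_mul, Complex.norm_exp_ofReal_mul_I, one_mul]
      refine (Real.norm_exp_I_mul_ofReal_sub_one_le).trans ?_
      rw [Real.norm_eq_abs, abs_of_nonneg (by linarith)]
      exact hj2
    have a1 := N.abs_sub_le_of_plane (Complex.exp (t * Complex.I))
      (Complex.exp ((j * δ : ℝ) * Complex.I))
    have a2 := S.abs_sub_le_of_plane (Complex.exp (t * Complex.I))
      (Complex.exp ((j * δ : ℝ) * Complex.I))
    rw [h j hj, h1, hI] at a2
    have hC : 0 ≤ N 1 + N Complex.I := add_nonneg (apply_nonneg _ _) (apply_nonneg _ _)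
    have a3 := mul_le_mul_of_nonneg_left hd hC
    rw [abs_le] at a1 a2 ⊢
    constructor <;> linarith [a1.1, a1.2, a2.1, a2.2]
  -- the upper half plane suffices since `N` and `S` are even
  have hup : ∀ z : ℂ, 0 ≤ z.arg → z.arg < Real.pi →
      |S z - N z| ≤ 2 * (N 1 + N Complex.I) * δ * ‖z‖ := by
    intro z h0 hpi
    have hz : z = ‖z‖ • Complex.exp (z.arg * Complex.I) := by
      simp
    have := hang z.arg h0 hpi
    conv_lhs => rw [hz]
    rw [map_smul_eq_mul, map_smul_eq_mul, norm_norm, ← mul_sub, abs_mul, abs_norm, mul_comm]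
    gcongr
  by_cases hz : 0 ≤ z.arg ∧ z.arg < Real.pi
  · exact hup z hz.1 hz.2
  · have hz0 : z ≠ 0 := by
      rintro rfl
      exact hz ⟨by simp, by simpa using Real.pi_pos⟩
    have hneg := hup (-z)
    rw [map_neg_eq_map, map_neg_eq_map, norm_neg] at hneg
    rw [not_and_or, not_le, not_lt] at hz
    rcases hz with hz | hz
    · have harg : (-z).arg = z.arg + Real.pi :=
        Complex.arg_neg_eq_arg_add_pi_of_im_neg (Complex.arg_neg_iff.1 hz)
      exact hneg (by linarith [Complex.neg_pi_lt_arg z]) (by linarith)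
    · have := (Complex.arg_eq_pi_iff.1 (le_antisymm (Complex.arg_le_pi z) hz))
      have h0 : (-z).arg = 0 :=
        Complex.arg_eq_zero_iff.2 ⟨by simpa using this.1.le, by simp [this.2]⟩
      exact hneg h0.ge (h0.trans_lt Real.pi_pos)

/-- The seminorm `z ↦ ∑ k, |w k z|` on the plane. -/
def sumAbsSeminorm {m : ℕ} (w : Fin m → ℂ →ₗ[ℝ] ℝ) : Seminorm ℝ ℂ :=
  Seminorm.of (fun z => ∑ k, |w k z|)
    (fun x y => by
      rw [← Finset.sum_add_distrib]
      exact Finset.sum_le_sum fun k _ => by rw [map_add]; exact abs_add_le _ _)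
    (fun a x => by simp only [map_smul, smul_eq_mul, abs_mul, Finset.mul_sum, Real.norm_eq_abs])

theorem sumAbsSeminorm_apply {m : ℕ} (w : Fin m → ℂ →ₗ[ℝ] ℝ) (z : ℂ) :
    sumAbsSeminorm w z = ∑ k, |w k z| := rfl

/-- On finitely many equidistributed directions a norm on the plane agrees with a norm of the form
`z ↦ ∑ k, |w k z|`. With `n (θ) = N (exp (i θ))`, convexity makes the coefficients
`n (θ + δ) + n (θ - δ) - 2 cos δ n θ` nonnegative. -/
theorem Seminorm.exists_sum_abs_eq_grid (N : Seminorm ℝ ℂ) (m : ℕ) (hm : 2 ≤ m) :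
    ∃ w : Fin m → ℂ →ₗ[ℝ] ℝ, ∀ j < m,
      sumAbsSeminorm w (Complex.exp ((j * (Real.pi / m) : ℝ) * Complex.I)) =
      N (Complex.exp ((j * (Real.pi / m) : ℝ) * Complex.I)) := by
  have hm0 : (0 : ℝ) < m := by exact_mod_cast (by omega : 0 < m)
  set δ := Real.pi / m with hδ
  have hδ0 : 0 < δ := by positivity
  have hδ2 : δ ≤ Real.pi / 2 := by
    rw [hδ]
    gcongr
    exact_mod_cast hm
  have hsin : 0 < Real.sin δ := Real.sin_pos_of_pos_of_lt_pi hδ0 (by linarith [Real.pi_pos])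
  have hcos : 0 ≤ Real.cos δ := Real.cos_nonneg_of_neg_pi_div_two_le_of_le
    (by linarith [Real.pi_pos]) hδ2
  set n : ℝ → ℝ := fun t => N (Complex.exp (t * Complex.I)) with hn
  have hper : ∀ t, n (t + Real.pi) = n t := by
    intro t
    simp only [hn]
    rw [Complex.ofReal_add, add_mul, Complex.exp_add, Complex.exp_pi_mul_I, mul_neg_one,
      map_neg_eq_map]
  set q : ℝ → ℝ := fun k => n ((k + 1) * δ) + n ((k - 1) * δ) - 2 * Real.cos δ * n (k * δ) with hq
  have hqnn : ∀ k, 0 ≤ q k := by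
    intro k
    have e : (2 * Real.cos δ) • Complex.exp ((k * δ : ℝ) * Complex.I) =
        Complex.exp (((k + 1) * δ : ℝ) * Complex.I) +
          Complex.exp (((k - 1) * δ : ℝ) * Complex.I) := by
      rw [Complex.real_smul]
      push_cast
      rw [Complex.two_cos, add_mul, ← Complex.exp_add, ← Complex.exp_add]
      ring_nf
    have := map_add_le_add N (Complex.exp (((k + 1) * δ : ℝ) * Complex.I))
      (Complex.exp (((k - 1) * δ : ℝ) * Complex.I))
    rw [← e, map_smul_eq_mul, Real.norm_of_nonneg (by positivity)] at this
    simp only [hq, hn]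
    linarith
  -- `z ↦ Im (exp (-iφ) z)`, which at `exp (iθ)` is `sin (θ - φ)`
  let rot : ℝ → ℂ →ₗ[ℝ] ℝ := fun φ =>
    Complex.imLm ∘ₗ LinearMap.mulLeft ℝ (Complex.exp ((-φ : ℝ) * Complex.I))
  have hrot : ∀ φ θ : ℝ, rot φ (Complex.exp (θ * Complex.I)) = Real.sin (θ - φ) := by
    intro φ θ
    simp only [rot, LinearMap.comp_apply, LinearMap.mulLeft_apply, ← Complex.exp_add, ← add_mul,
      ← Complex.ofReal_add]
    rw [show -φ + θ = θ - φ by ring]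
    exact Complex.exp_ofReal_mul_I_im _
  refine ⟨fun k => (q (k : ℕ) / (2 * Real.sin δ)) • rot ((k : ℕ) * δ), fun j hj => ?_⟩
  have key := sum_second_difference_mul_abs_sin n hper m (by omega) j hj
  rw [sumAbsSeminorm_apply, Fin.sum_univ_eq_sum_range (fun k : ℕ => |((q k / (2 * Real.sin δ)) •
    rot (k * δ)) (Complex.exp ((j * δ : ℝ) * Complex.I))|)]
  have : ∀ k ∈ Finset.range m, |((q k / (2 * Real.sin δ)) • rot (k * δ))
      (Complex.exp ((j * δ : ℝ) * Complex.I))| =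
      (q k * |Real.sin ((k - j) * δ)|) / (2 * Real.sin δ) := by
    intro k _
    rw [LinearMap.smul_apply, hrot, smul_eq_mul, abs_mul,
      abs_of_nonneg (div_nonneg (hqnn k) (by positivity)),
      show (j : ℝ) * δ - k * δ = -((k - j) * δ) by ring, Real.sin_neg, abs_neg]
    ring
  rw [Finset.sum_congr rfl this, ← Finset.sum_div, key]
  exact mul_div_cancel_left₀ _ (by positivity)

/-- Every norm on the plane is, up to `1 ± ε`, of the form `z ↦ ∑ k, |w k z|`. -/
theorem Seminorm.exists_sum_abs_near (N : Seminorm ℝ ℂ) {κ : ℝ} (hκ : ∀ z, ‖z‖ ≤ κ * N z)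
    {ε : ℝ} (hε : 0 < ε) : ∃ (m : ℕ) (w : Fin m → ℂ →ₗ[ℝ] ℝ),
      ∀ z, (1 - ε) * N z ≤ ∑ k, |w k z| ∧ ∑ k, |w k z| ≤ (1 + ε) * N z := by
  have hκ0 : 0 < κ := by
    have := hκ 1
    rw [norm_one] at this
    exact pos_of_mul_pos_left (by linarith) (apply_nonneg N 1)
  have hC : 0 ≤ N 1 + N Complex.I := add_nonneg (apply_nonneg _ _) (apply_nonneg _ _)
  obtain ⟨r, hr⟩ := exists_nat_gt ((N 1 + N Complex.I) * Real.pi * κ / ε)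
  have hr0 : (0 : ℝ) < r := lt_of_le_of_lt (by positivity) hr
  have hr1 : 0 < r := by exact_mod_cast hr0
  obtain ⟨w, hw⟩ := N.exists_sum_abs_eq_grid (2 * r) (by omega)
  refine ⟨2 * r, w, fun z => ?_⟩
  have h1 := N.abs_sub_le_of_eq_grid (sumAbsSeminorm w) r hr1 hw z
  rw [sumAbsSeminorm_apply] at h1
  have h2 : 2 * (N 1 + N Complex.I) * (Real.pi / (2 * r : ℕ)) * ‖z‖ ≤ ε * N z := by
    rw [div_lt_iff₀ hε] at hr
    calc 2 * (N 1 + N Complex.I) * (Real.pi / (2 * r : ℕ)) * ‖z‖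
        ≤ 2 * (N 1 + N Complex.I) * (Real.pi / (2 * r : ℕ)) * (κ * N z) := by
          gcongr
          exact hκ z
      _ = ((N 1 + N Complex.I) * Real.pi * κ) / r * N z := by
          push_cast
          field_simp
      _ ≤ ε * N z := by
          gcongr
          rw [div_le_iff₀ hr0]
          linarith
  have h3 := abs_le.1 (h1.trans h2)
  constructor <;> linarith [h3.1, h3.2]

/-- The dual of a two-dimensional normed space embeds almost isometrically into `ℓ₁ᵐ` for a
suitable `m`. -/
theorem exists_sum_abs_dual_near {X : Type*} [NormedAddCommGroup X] [NormedSpace ℝ X]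
    (hX : Module.finrank ℝ X = 2) {ε : ℝ} (hε : 0 < ε) :
    ∃ (m : ℕ) (y : Fin m → X), ∀ g : StrongDual ℝ X,
      (1 - ε) * ‖g‖ ≤ ∑ k, |g (y k)| ∧ ∑ k, |g (y k)| ≤ ‖g‖ := by
  have : FiniteDimensional ℝ X := .of_finrank_pos (by omega)
  have hdual : Module.finrank ℝ (StrongDual ℝ X) = 2 := by
    rw [← hX, ← (LinearMap.toContinuousLinearMap (𝕜 := ℝ) (E := X) (F' := ℝ)).finrank_eq]
    exact Subspace.dual_finrank_eq
  have : FiniteDimensional ℝ (StrongDual ℝ X) := .of_finrank_pos (by omega)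
  let e : ℂ ≃L[ℝ] StrongDual ℝ X :=
    ContinuousLinearEquiv.ofFinrankEq (by rw [hdual, Complex.finrank_real_complex])
  obtain ⟨m, w, hw⟩ := Seminorm.exists_sum_abs_near
    ((normSeminorm ℝ (StrongDual ℝ X)).comp (e : ℂ →ₗ[ℝ] StrongDual ℝ X))
    (κ := ‖(e.symm : StrongDual ℝ X →L[ℝ] ℂ)‖)
    (fun z => by simpa using (e.symm : StrongDual ℝ X →L[ℝ] ℂ).le_opNorm (e z)) (half_pos hε)
  -- by reflexivity every functional on the dual is an evaluation
  have heval : ∀ φ : StrongDual ℝ X →ₗ[ℝ] ℝ, ∃ x : X, ∀ g, φ g = g x := by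
    intro φ
    obtain ⟨x, hx⟩ := (Module.evalEquiv ℝ X).surjective
      (φ ∘ₗ (LinearMap.toContinuousLinearMap (𝕜 := ℝ) (E := X) (F' := ℝ)).toLinearMap)
    refine ⟨x, fun g => ?_⟩
    have := LinearMap.congr_fun hx (g : X →ₗ[ℝ] ℝ)
    exact this.symm
  choose x hx using fun k => heval (w k ∘ₗ (e.symm : StrongDual ℝ X →ₗ[ℝ] ℂ))
  -- rescaling turns the upper bound `1 + ε / 2` into `1`
  refine ⟨m, fun k => (1 + ε / 2)⁻¹ • x k, fun g => ?_⟩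
  have h1 := hw (e.symm g)
  have h2 : ∀ k, w k (e.symm g) = g (x k) := fun k => hx k g
  simp only [h2, Seminorm.comp_apply, coe_normSeminorm, LinearEquiv.coe_coe,
    ContinuousLinearEquiv.coe_toLinearEquiv,
    ContinuousLinearEquiv.apply_symm_apply] at h1
  simp only [map_smul, smul_eq_mul, abs_mul, ← Finset.mul_sum]
  rw [abs_of_pos (by positivity), le_inv_mul_iff₀ (by positivity), inv_mul_le_iff₀ (by positivity)]
  refine ⟨le_trans ?_ h1.1, h1.2⟩
  nlinarith [norm_nonneg g, mul_nonneg (sq_nonneg ε) (norm_nonneg g)]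

/-! ### The spaces `ℓ₁` and `L₁` have octahedral norms -/

theorem EllOne.summable_abs (a : EllOne) : Summable fun n => |a n| := by
  simpa using (lp.memℓp a).summable (by simp)

theorem EllOne.norm_eq_tsum (a : EllOne) : ‖a‖ = ∑' n, |a n| := by
  rw [lp.norm_eq_tsum_rpow (by simp)]
  simp

theorem EllOne.tendsto_zero (a : EllOne) : Filter.Tendsto (fun n => a n) Filter.atTop (nhds 0) :=
  a.summable_abs.of_abs.tendsto_atTop_zero

theorem hasOctahedralNorm_ellOne : HasOctahedralNorm EllOne := by
  refine .of_dense dense_univ (Set.mem_univ _) fun F _ ε hε _ => ?_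
  -- a coordinate at which all members of `F` are small
  obtain ⟨n, hn⟩ : ∃ n, ∀ x ∈ F, 2 * |x n| ≤ ε * ‖x‖ := by
    have : ∀ᶠ n in Filter.atTop, ∀ x ∈ F, 2 * |x n| ≤ ε * ‖x‖ := by
      refine (Finset.eventually_all F).2 fun x _ => ?_
      rcases eq_or_ne x 0 with rfl | hx
      · simp
      · have h1 : Filter.Tendsto (fun n => 2 * |x n|) Filter.atTop (nhds 0) := by
          simpa using (x.tendsto_zero.abs).const_mul 2
        exact h1.eventually_le_const (by have := norm_pos_iff.2 hx; positivity)
    exact this.exists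
  refine ⟨lp.single 1 n 1, by simp [lp.norm_single], fun x hx c => ?_⟩
  have h1 : ‖x‖ + (|c| - 2 * |x n|) ≤ ‖x + c • (lp.single 1 n 1 : EllOne)‖ := by
    rw [EllOne.norm_eq_tsum x, EllOne.norm_eq_tsum (x + _)]
    refine hasSum_le (fun k => ?_) (x.summable_abs.hasSum.add (hasSum_ite_eq n (|c| - 2 * |x n|)))
      (EllOne.summable_abs _).hasSum
    rw [lp.coeFn_add, lp.coeFn_smul, Pi.add_apply, Pi.smul_apply]
    rcases eq_or_ne k n with rfl | hk
    · rw [if_pos rfl, lp.single_apply_self, smul_eq_mul, mul_one]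
      have := abs_sub_abs_le_abs_sub c (-x k)
      rw [abs_neg, sub_neg_eq_add, add_comm c] at this
      linarith
    · rw [if_neg hk, lp.single_apply_ne _ _ _ hk]
      simp
  nlinarith [hn x hx, abs_nonneg c]

open MeasureTheory in
theorem hasOctahedralNorm_lOne : HasOctahedralNorm LOne := by
  set μ : Measure ℝ := volume.restrict (Set.Icc (0 : ℝ) 1) with hμ
  refine .of_dense dense_univ (Set.mem_univ _) fun F _ ε hε _ => ?_
  let A : ℕ → Set ℝ := fun n => Set.Iic (1 / ((n : ℝ) + 1))
  have hA : ∀ n, MeasurableSet (A n) := fun n => measurableSet_Iic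
  have hμA : ∀ n, μ (A n) = ENNReal.ofReal (1 / ((n : ℝ) + 1)) := by
    intro n
    rw [hμ, Measure.restrict_apply (hA n)]
    have : A n ∩ Set.Icc 0 1 = Set.Icc 0 (1 / ((n : ℝ) + 1)) := by
      ext t
      have : 1 / ((n : ℝ) + 1) ≤ 1 := by
        rw [div_le_one (by positivity)]
        linarith [Nat.cast_nonneg (α := ℝ) n]
      simp only [A, Set.mem_inter_iff, Set.mem_Iic, Set.mem_Icc]
      constructor
      · rintro ⟨h1, h2, h3⟩; exact ⟨h2, h1⟩
      · rintro ⟨h1, h2⟩; exact ⟨h2, h1, h2.trans this⟩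
    rw [this, Real.volume_Icc, sub_zero]
  have hμ0 : Filter.Tendsto (fun n => μ (A n)) Filter.atTop (nhds 0) := by
    simp only [hμA]
    simpa using ENNReal.tendsto_ofReal (tendsto_one_div_add_atTop_nhds_zero_nat (𝕜 := ℝ))
  -- a set of positive measure on which all members of `F` have small integral
  obtain ⟨n, hn⟩ : ∃ n, ∀ x ∈ F, 2 * ∫ t in A n, |x t| ∂μ ≤ ε * ‖x‖ := by
    have : ∀ᶠ n in Filter.atTop, ∀ x ∈ F, 2 * ∫ t in A n, |x t| ∂μ ≤ ε * ‖x‖ := by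
      refine (Finset.eventually_all F).2 fun x _ => ?_
      rcases eq_or_ne x 0 with rfl | hx
      · refine Filter.Eventually.of_forall fun n => ?_
        have : ∫ t in A n, |(0 : LOne) t| ∂μ = 0 := by
          refine integral_eq_zero_of_ae (ae_restrict_of_ae ?_)
          filter_upwards [Lp.coeFn_zero ℝ 1 μ] with t ht
          exact abs_eq_zero.2 ht
        rw [this]
        simp
      · have h1 := ((L1.integrable_coeFn x).abs.tendsto_setIntegral_nhds_zero hμ0).const_mul 2
        rw [mul_zero] at h1
        exact h1.eventually_le_const (by have := norm_pos_iff.2 hx; positivity)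
    exact this.exists
  have hreal : μ.real (A n) = 1 / ((n : ℝ) + 1) := by
    rw [measureReal_def, hμA, ENNReal.toReal_ofReal (by positivity)]
  have hfin : μ (A n) ≠ ⊤ := measure_ne_top _ _
  refine ⟨indicatorConstLp 1 (hA n) hfin ((n : ℝ) + 1), ?_, fun x hx c => ?_⟩
  · rw [norm_indicatorConstLp (by simp) (by simp), hreal, Real.norm_of_nonneg (by positivity)]
    simp only [ENNReal.toReal_one, div_one, Real.rpow_one]
    exact (mul_one_div_cancel (by positivity)).le
  set y : LOne := indicatorConstLp 1 (hA n) hfin ((n : ℝ) + 1) with hy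
  have hyae : y =ᵐ[μ] (A n).indicator fun _ => (n : ℝ) + 1 := indicatorConstLp_coeFn
  have hxi : Integrable (fun t => |x t|) μ := (L1.integrable_coeFn x).abs
  have hIi : Integrable (fun t => (A n).indicator (fun t => |c| * ((n : ℝ) + 1) - 2 * |x t|) t) μ :=
    ((integrable_const _).sub (hxi.const_mul 2)).indicator (hA n)
  have hval : ∫ t, (A n).indicator (fun t => |c| * ((n : ℝ) + 1) - 2 * |x t|) t ∂μ =
      |c| - 2 * ∫ t in A n, |x t| ∂μ := by
    rw [integral_indicator (hA n), integral_sub (integrable_const _)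
      (hxi.const_mul 2).integrableOn, setIntegral_const, hreal, integral_const_mul]
    congr 1
    rw [smul_eq_mul]
    field_simp
  have h1 : ‖x‖ + (|c| - 2 * ∫ t in A n, |x t| ∂μ) ≤ ‖x + c • y‖ := by
    rw [L1.norm_eq_integral_norm x, L1.norm_eq_integral_norm (x + _), ← hval]
    simp only [Real.norm_eq_abs]
    rw [← integral_add hxi hIi]
    refine integral_mono_ae (hxi.add hIi) (L1.integrable_coeFn _).abs ?_
    filter_upwards [hyae, Lp.coeFn_add x (c • y), Lp.coeFn_smul c y] with t h1 h2 h3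
    rw [h2, Pi.add_apply, h3, Pi.smul_apply, h1]
    by_cases ht : t ∈ A n
    · rw [Set.indicator_of_mem ht, Set.indicator_of_mem ht, smul_eq_mul]
      have := abs_sub_abs_le_abs_sub (c * ((n : ℝ) + 1)) (-x t)
      rw [abs_neg, sub_neg_eq_add, add_comm (c * _), abs_mul,
        abs_of_pos (show (0 : ℝ) < (n : ℝ) + 1 by positivity)] at this
      linarith
    · simp [Set.indicator_of_notMem ht]
  nlinarith [hn x hx, abs_nonneg c]

/-! ### The dual of `c₀` -/

namespace CZero

theorem abs_apply_le (z : CZero) (n : ℕ) : |z n| ≤ ‖z‖ := by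
  rw [← ZeroAtInftyContinuousMap.norm_toBCF_eq_norm]
  exact z.toBCF.norm_coe_le_norm n

theorem norm_le {z : CZero} {C : ℝ} (hC : 0 ≤ C) (h : ∀ n, |z n| ≤ C) : ‖z‖ ≤ C := by
  rw [← ZeroAtInftyContinuousMap.norm_toBCF_eq_norm]
  exact (BoundedContinuousFunction.norm_le hC).2 h

/-- The unit vector `e n` of `c₀`. -/
def unitVec (n : ℕ) : CZero where
  toFun := fun k => if k = n then 1 else 0
  continuous_toFun := continuous_of_discreteTopology
  zero_at_infty' := by
    rw [Filter.cocompact_eq_cofinite]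
    refine tendsto_const_nhds.congr' ?_
    filter_upwards [(Set.finite_singleton n).compl_mem_cofinite] with k hk
    exact (if_neg hk).symm

theorem unitVec_apply (n k : ℕ) : unitVec n k = if k = n then 1 else 0 :=
  rfl

theorem sum_smul_unitVec_apply (s : Finset ℕ) (v : ℕ → ℝ) (k : ℕ) :
    (∑ n ∈ s, v n • unitVec n) k = if k ∈ s then v k else 0 := by
  classical
  induction s using Finset.induction_on with
  | empty => simp
  | insert i s hi ih =>
    rw [Finset.sum_insert hi, ZeroAtInftyContinuousMap.add_apply, ih,
      ZeroAtInftyContinuousMap.smul_apply, unitVec_apply]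
    by_cases hk : k = i
    · subst hk
      simp [hi]
    · simp [hk]

theorem hasSum_smul_unitVec (z : CZero) : HasSum (fun n => z n • unitVec n) z := by
  rw [HasSum, SummationFilter.unconditional_filter, Metric.tendsto_atTop]
  intro ε hε
  have hz : Filter.Tendsto z Filter.cofinite (nhds 0) := by
    rw [← Filter.cocompact_eq_cofinite]
    exact z.zero_at_infty'
  have hfin : {n | ¬ |z n| < ε / 2}.Finite := by
    have := hz.abs.eventually_lt_const (u := ε / 2) (by simpa using hε)
    exact this
  refine ⟨hfin.toFinset, fun s hs => ?_⟩
  rw [dist_eq_norm]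
  refine lt_of_le_of_lt (norm_le (C := ε / 2) (by positivity) fun k => ?_) (by linarith)
  rw [ZeroAtInftyContinuousMap.sub_apply, sum_smul_unitVec_apply]
  split_ifs with hk
  · simpa using (half_pos hε).le
  · rw [zero_sub, abs_neg]
    by_contra hcon
    exact hk (hs (hfin.mem_toFinset.2 fun h => hcon h.le))

theorem sum_abs_le_norm (φ : StrongDual ℝ CZero) (s : Finset ℕ) :
    ∑ n ∈ s, |φ (unitVec n)| ≤ ‖φ‖ := by
  have h1 : φ (∑ n ∈ s, (SignType.sign (φ (unitVec n)) : ℝ) • unitVec n) =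
      ∑ n ∈ s, |φ (unitVec n)| := by
    rw [map_sum]
    refine Finset.sum_congr rfl fun n _ => ?_
    rw [map_smul, smul_eq_mul, sign_mul_self]
  rw [← h1]
  refine (le_abs_self _).trans (φ.le_of_opNorm_le_of_le le_rfl
    (norm_le (C := 1) zero_le_one fun k => ?_) |>.trans (mul_one _).le)
  rw [sum_smul_unitVec_apply]
  split_ifs
  · rcases lt_trichotomy (φ (unitVec k)) 0 with h | h | h <;> simp [h]
  · simp

end CZero

theorem EllOne.abs_mul_le (a : EllOne) (z : CZero) (n : ℕ) : |a n * z n| ≤ |a n| * ‖z‖ := by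
  rw [abs_mul]
  exact mul_le_mul_of_nonneg_left (z.abs_apply_le n) (abs_nonneg _)

theorem EllOne.summable_mul (a : EllOne) (z : CZero) : Summable fun n => |a n * z n| :=
  .of_nonneg_of_le (fun _ => abs_nonneg _)
    (a.abs_mul_le z) (a.summable_abs.mul_right ‖z‖)

theorem EllOne.abs_tsum_mul_le (a : EllOne) (z : CZero) : |∑' n, a n * z n| ≤ ‖a‖ * ‖z‖ := by
  rw [EllOne.norm_eq_tsum, ← tsum_mul_right]
  refine (norm_tsum_le_tsum_norm (f := fun n => a n * z n) (a.summable_mul z)).trans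
    ((a.summable_mul z).tsum_le_tsum (a.abs_mul_le z) (a.summable_abs.mul_right ‖z‖))

/-- The duality `⟨a, z⟩ = ∑ n, a n * z n`, as a map from `ℓ₁` to the dual of `c₀`. -/
def EllOne.toDual : EllOne →L[ℝ] StrongDual ℝ CZero :=
  LinearMap.mkContinuous₂
    (LinearMap.mk₂ ℝ (fun (a : EllOne) (z : CZero) => ∑' n, a n * z n)
      (fun a b z => by
        rw [← (a.summable_mul z).of_abs.tsum_add (b.summable_mul z).of_abs]
        simp [add_mul])
      (fun r a z => by simp [mul_assoc, tsum_mul_left])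
      (fun a z w => by
        rw [← (a.summable_mul z).of_abs.tsum_add (a.summable_mul w).of_abs]
        simp [mul_add])
      (fun r a z => by simp [mul_left_comm, tsum_mul_left]))
    1 (fun a z => by simpa using a.abs_tsum_mul_le z)

theorem EllOne.toDual_apply (a : EllOne) (z : CZero) : toDual a z = ∑' n, a n * z n := rfl

theorem EllOne.toDual_unitVec (a : EllOne) (n : ℕ) : toDual a (CZero.unitVec n) = a n := by
  simp [toDual_apply, CZero.unitVec_apply]

theorem EllOne.norm_toDual (a : EllOne) : ‖toDual a‖ = ‖a‖ := by
  refine le_antisymm ?_ ?_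
  · exact ContinuousLinearMap.opNorm_le_bound _ (norm_nonneg a) a.abs_tsum_mul_le
  · rw [EllOne.norm_eq_tsum]
    refine a.summable_abs.tsum_le_of_sum_le fun s => ?_
    simpa only [toDual_unitVec] using CZero.sum_abs_le_norm (toDual a) s

theorem EllOne.toDual_surjective : Function.Surjective toDual := by
  intro φ
  have hsum : Summable fun n => |φ (CZero.unitVec n)| :=
    summable_of_sum_le (fun _ => abs_nonneg _) (CZero.sum_abs_le_norm φ)
  let a : EllOne := ⟨fun n => φ (CZero.unitVec n), memℓp_gen (by simpa using hsum)⟩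
  refine ⟨a, ContinuousLinearMap.ext fun z => ?_⟩
  have h1 := (φ.hasSum (CZero.hasSum_smul_unitVec z)).tsum_eq
  rw [← h1, toDual_apply]
  refine tsum_congr fun n => ?_
  simp [a, mul_comm]

/-! ### The injective tensor product of `ℓ₁` and `X` -/

section Operators

variable {X : Type*} [NormedAddCommGroup X] [NormedSpace ℝ X]

/-- The operator from `c₀` to `X` defined by a tensor in `ℓ₁ ⊗ X`; it sends `z` to `⟨a, z⟩ x`
for the tensor `a ⊗ x`. -/
def AlgInjTensor.toOperator : AlgInjTensor EllOne X →ₗ[ℝ] (CZero →L[ℝ] X) :=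
  TensorProduct.lift (LinearMap.mk₂ ℝ
    (fun (a : EllOne) (x : X) => (EllOne.toDual a).smulRight x)
    (fun a b x => by ext z; simp [add_smul])
    (fun r a x => by ext z; simp [mul_smul])
    (fun a x y => by ext z; simp)
    (fun r a x => by ext z; simp [smul_comm r])) ∘ₗ
    (ofTensor (X := EllOne) (Y := X)).symm.toLinearMap

namespace AlgInjTensor

@[simp]
theorem toOperator_tmul (a : EllOne) (x : X) :
    toOperator (tmul a x) = (EllOne.toDual a).smulRight x := by
  simp [toOperator, tmul]

theorem comp_toOperator (g : StrongDual ℝ X) (u : AlgInjTensor EllOne X) :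
    g.comp (toOperator u) = EllOne.toDual (slice g u) := by
  induction u using induction_tmul with
  | zero => simp
  | tmul a x => ext z; simp [mul_comm]
  | add u v hu hv => simp [hu, hv]

theorem norm_toOperator (u : AlgInjTensor EllOne X) : ‖toOperator u‖ = ‖u‖ := by
  refine le_antisymm ?_ (norm_le_of_slice fun g hg => ?_)
  · refine ContinuousLinearMap.opNorm_le_bound _ (norm_nonneg u) fun z => ?_
    obtain ⟨g, hg, hgz⟩ := exists_dual_vector'' ℝ (toOperator u z)
    have h1 : EllOne.toDual (slice g u) z = ‖toOperator u z‖ := by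
      rw [← comp_toOperator]
      exact hgz
    rw [← h1]
    exact (le_abs_self _).trans (((EllOne.toDual _).le_opNorm z).trans
      (mul_le_mul_of_nonneg_right ((EllOne.norm_toDual _).trans_le (norm_slice_le hg u))
        (norm_nonneg z)))
  · rw [← EllOne.norm_toDual, ← comp_toOperator]
    exact (g.opNorm_comp_le _).trans (mul_le_of_le_one_left (norm_nonneg _) hg)

theorem toOperator_injective : Function.Injective (toOperator (X := X)) := by
  refine (injective_iff_map_eq_zero _).2 fun u hu => ?_
  rw [← norm_eq_zero, ← norm_toOperator, hu]
  exact ContinuousLinearMap.opNorm_zero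

theorem toOperator_surjective [FiniteDimensional ℝ X] :
    Function.Surjective (toOperator (X := X)) := by
  intro T
  let b := Module.finBasis ℝ X
  choose a ha using fun i => EllOne.toDual_surjective
    ((LinearMap.toContinuousLinearMap (b.coord i)).comp T)
  refine ⟨∑ i, tmul (a i) (b i), ContinuousLinearMap.ext fun z => ?_⟩
  rw [map_sum, sum_apply]
  simp only [toOperator_tmul, ha, ContinuousLinearMap.smulRight_apply,
    ContinuousLinearMap.comp_apply, LinearMap.coe_toContinuousLinearMap', Module.Basis.coord_apply]
  exact b.sum_repr (T z)

end AlgInjTensor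

/-- A linear bijection from a normed space onto a Banach space that preserves norms extends to the
completion. -/
theorem exists_completion_linearIsometryEquiv {V W : Type*} [NormedAddCommGroup V]
    [NormedSpace ℝ V] [NormedAddCommGroup W] [NormedSpace ℝ W] [CompleteSpace W] (f : V ≃ₗ[ℝ] W)
    (hf : ∀ v, ‖f v‖ = ‖v‖) :
    ∃ Φ : UniformSpace.Completion V ≃ₗᵢ[ℝ] W, ∀ v : V, Φ v = f v := by
  have h : ∀ v, ‖(LinearMap.id : W →ₗ[ℝ] W) (f v)‖ =
      ‖(UniformSpace.Completion.toComplL (𝕜 := ℝ) (E := V)).toLinearMap v‖ :=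
    fun v => (hf v).trans (UniformSpace.Completion.norm_coe v).symm
  exact ⟨f.extendOfIsometry _ _ UniformSpace.Completion.denseRange_coe
    Function.surjective_id.denseRange h, f.extendOfIsometry_eq _ _ _ _ h⟩

/-- For finite-dimensional `X` the injective tensor product of `ℓ₁` and `X` is the space of
bounded operators from `c₀` to `X`. -/
theorem InjTensor.exists_operatorEquiv [FiniteDimensional ℝ X] :
    ∃ Φ : InjTensor EllOne X ≃ₗᵢ[ℝ] (CZero →L[ℝ] X),
      ∀ (a : EllOne) (x : X), Φ (tmul a x) = (EllOne.toDual a).smulRight x := by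
  have : CompleteSpace X := FiniteDimensional.complete ℝ X
  obtain ⟨Φ, hΦ⟩ := exists_completion_linearIsometryEquiv (W := CZero →L[ℝ] X)
    (LinearEquiv.ofBijective AlgInjTensor.toOperator
      ⟨AlgInjTensor.toOperator_injective, AlgInjTensor.toOperator_surjective⟩)
    AlgInjTensor.norm_toOperator
  exact ⟨Φ, fun a x => (hΦ (AlgInjTensor.tmul a x)).trans (AlgInjTensor.toOperator_tmul a x)⟩

end Operators

end

theorem mainTheorem7 (X : Type*) [NormedAddCommGroup X] [NormedSpace ℝ X]
    (hX : Module.finrank ℝ X = 2) :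
    (∃ Φ : InjTensor EllOne X ≃ₗᵢ[ℝ] (CZero →L[ℝ] X),
      ∀ (a : EllOne) (x : X) (z : CZero),
        HasSum (fun n : ℕ => (a n * z n) • x) (Φ (InjTensor.tmul a x) z)) ∧
    HasOctahedralNorm (InjTensor EllOne X) ∧
    HasOctahedralNorm (CZero →L[ℝ] X) ∧
    HasOctahedralNorm (InjTensor LOne X) := by
  have : FiniteDimensional ℝ X := .of_finrank_pos (by omega)
  have : Nontrivial X := Module.nontrivial_of_finrank_pos (R := ℝ) (by omega)
  have hℓ : HasOctahedralNorm (InjTensor EllOne X) :=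
    hasOctahedralNorm_ellOne.injTensor fun _ hε => exists_sum_abs_dual_near hX hε
  obtain ⟨Φ, hΦ⟩ := InjTensor.exists_operatorEquiv (X := X)
  refine ⟨⟨Φ, fun a x z => ?_⟩, hℓ,
    hℓ.of_linearIsometryEquiv Φ,
    hasOctahedralNorm_lOne.injTensor fun _ hε => exists_sum_abs_dual_near hX hε⟩
  rw [hΦ]
  exact (a.summable_mul z).of_abs.hasSum.smul_const x
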